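/- Let $\mathbf{FdContraction}$ be the category whose objects are the finite-dimensional complex Hilbert spaces and whose morphisms $A\to B$ are the contractions, i.e. the linear maps $f$ with $\|f(a)\|\le\|a\|$ for all $a\in A$. It is symmetric monoidal under the orthogonal direct sum $\oplus$, with unit $\{0\}$. For a linear map $f : A\oplus U\to B\oplus U$ let $f_{BA}:A\to B$, $f_{BU}:U\to B$, $f_{UA}:A\to U$ and $f_{UU}:U\to U$ be its matrix components. The execution formula is the partial operator which assigns to a morphism $f : A\oplus U\to B\oplus U$ of $\mathbf{FdContraction}$ the sum $$\mathrm{ex}^U(f)=\Sigma\big(\{f_{BA}\}\uplus\{f_{BU}\,f_{UU}^{\,n}\,f_{UA}\}_{n\in\mathbb N}\big),$$ where $\Sigma$ is the limit, in the operator norm, of the net of finite partial sums; $\mathrm{ex}^U(f)$ is defined if this limit exists and is a contraction $A\to B$. The kernel-image trace $\mathrm{Tr}_{\mathrm{ki}}^U(f)$ of a linear map $f : A\oplus U\to B\oplus U$ between finite-dimensional Hilbert spaces is defined if there are linear maps $i:A\to U$ and $k:U\to B$ with $(\mathrm{id}_U-f_{UU})\,i=f_{UA}$ and $k\,(\mathrm{id}_U-f_{UU})=f_{BU}$,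 and its value is then $f_{BA}+k f_{UA}=f_{BA}+f_{BU}\,i$, which does not depend on the choice of $(k,i)$. **Theorem.** $(\mathbf{FdContraction},\oplus,\mathrm{ex})$ is a totally traced monoidal category. That is, $\mathrm{ex}^U(f)$ is defined for every morphism $f:A\oplus U\to B\oplus U$ of $\mathbf{FdContraction}$, and the following hold for all objects and all morphisms of $\mathbf{FdContraction}$ of the types indicated, where $\rho$, $\alpha$, $\sigma$ are the right unitor, the associator $(X\oplus Y)\oplus Z\to X\oplus(Y\oplus Z)$ and the symmetry: * naturality: $h\circ \mathrm{ex}^U(f)\circ g=\mathrm{ex}^U((h\oplus\mathrm{id}_U)\circ f\circ(g\oplus\mathrm{id}_U))$ for $f:A\oplus U\to B\oplus U$, $g:A'\to A$, $h:B\to B'$; * dinaturality: $\mathrm{ex}^U((\mathrm{id}_B\oplus g)\circ f)=\mathrm{ex}^{U'}(f\circ(\mathrm{id}_A\oplus g))$ for $f:A\oplus U\to B\oplus U'$, $g:U'\to U$; * superposing: $g\oplus \mathrm{ex}^U(f)=\mathrm{ex}^U(\alpha^{-1}\circ(g\oplus f)\circ\alpha)$ for $f:A\oplus U\to B\oplus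 U$, $g:C\to D$; * vanishing I: $\mathrm{ex}^{\{0\}}(f)=\rho\circ f\circ\rho^{-1}$ for $f:A\oplus\{0\}\to B\oplus\{0\}$; * vanishing II: $\mathrm{ex}^U(\mathrm{ex}^V(f))=\mathrm{ex}^{U\oplus V}(\alpha\circ f\circ\alpha^{-1})$ for $f:(A\oplus U)\oplus V\to (B\oplus U)\oplus V$; * yanking: $\mathrm{ex}^U(\sigma_{U,U})=\mathrm{id}_U$. Moreover, for every contraction $f:A\oplus U\to B\oplus U$ between finite-dimensional Hilbert spaces, the net of finite partial sums of the family $\{f_{BA}\}\uplus\{f_{BU}f_{UU}^{\,n}f_{UA}\}_{n\in\mathbb N}$ converges in the operator norm, $\mathrm{Tr}_{\mathrm{ki}}^U(f)$ is defined and is equal to its limit, and this limit is again a contraction. -/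

import Mathlib

open CategoryTheory MonoidalCategory

universe u v w

noncomputable section

/-! ### Traced monoidal categories -/

/-- A (total) family of operators `Tr : C(A ⊗ U, B ⊗ U) → C(A, B)` on a symmetric monoidal category
is a trace if it satisfies naturality, dinaturality, superposing, vanishing I and II, and yanking.
The coherence isomorphisms are written out. -/
structure IsTrace {C : Type u} [Category.{v} C] [MonoidalCategory C] [SymmetricCategory C]
    (Tr : ∀ {A B U : C}, (A ⊗ U ⟶ B ⊗ U) → (A ⟶ B)) : Prop where
  naturality : ∀ {A A' B B' U : C} (f : A ⊗ U ⟶ B ⊗ U) (g : A' ⟶ A) (h : B ⟶ B'),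
    g ≫ Tr f ≫ h = Tr ((g ▷ U) ≫ f ≫ (h ▷ U))
  dinaturality : ∀ {A B U U' : C} (f : A ⊗ U ⟶ B ⊗ U') (g : U' ⟶ U),
    Tr (f ≫ (B ◁ g)) = Tr ((A ◁ g) ≫ f)
  superposing : ∀ {A B C' D U : C} (f : A ⊗ U ⟶ B ⊗ U) (g : C' ⟶ D),
    (g ⊗ₘ Tr f) = Tr ((α_ C' A U).hom ≫ (g ⊗ₘ f) ≫ (α_ D B U).inv)
  vanishing_one : ∀ {A B : C} (f : A ⊗ 𝟙_ C ⟶ B ⊗ 𝟙_ C),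
    Tr f = (ρ_ A).inv ≫ f ≫ (ρ_ B).hom
  vanishing_two : ∀ {A B U V : C} (f : (A ⊗ U) ⊗ V ⟶ (B ⊗ U) ⊗ V),
    Tr (Tr f) = Tr ((α_ A U V).inv ≫ f ≫ (α_ B U V).hom)
  yanking : ∀ U : C, Tr (β_ U U).hom = 𝟙 U

/-- A family of partial operators `C(A ⊗ U, B ⊗ U) ⇀ C(A, B)` makes the symmetric monoidal
category `C` totally traced if every operator is everywhere defined and the resulting family of
total operators is a trace. -/
def IsTotallyTraced (C : Type u) [Category.{v} C] [MonoidalCategory C] [SymmetricCategory C]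
    (Tr : ∀ {A B U : C}, (A ⊗ U ⟶ B ⊗ U) →. (A ⟶ B)) : Prop :=
  ∃ h : ∀ {A B U : C} (f : A ⊗ U ⟶ B ⊗ U), (Tr f).Dom,
    IsTrace (fun {A B U : C} (f : A ⊗ U ⟶ B ⊗ U) => (Tr f).get (h f))

/-! ### Bounded operators between direct sums of Hilbert spaces -/

section Operators

variable {A : Type u} [NormedAddCommGroup A] [InnerProductSpace ℂ A]
  {B : Type v} [NormedAddCommGroup B] [InnerProductSpace ℂ B]
  {U : Type w} [NormedAddCommGroup U] [InnerProductSpace ℂ U]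

/-- A (weak) contraction. -/
def IsContraction (f : A →L[ℂ] B) : Prop := ∀ a, ‖f a‖ ≤ ‖a‖

namespace DirectSum2

/-- The projection `A ⊕ B → A`. -/
def fst (A : Type u) [NormedAddCommGroup A] [InnerProductSpace ℂ A]
    (B : Type v) [NormedAddCommGroup B] [InnerProductSpace ℂ B] : WithLp 2 (A × B) →L[ℂ] A :=
  WithLp.fstL 2 ℂ A B

/-- The projection `A ⊕ B → B`. -/
def snd (A : Type u) [NormedAddCommGroup A] [InnerProductSpace ℂ A]
    (B : Type v) [NormedAddCommGroup B] [InnerProductSpace ℂ B] : WithLp 2 (A × B) →L[ℂ] B :=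
  WithLp.sndL 2 ℂ A B

/-- The map `x ↦ (f x, g x)` into the direct sum. -/
def pair (f : U →L[ℂ] A) (g : U →L[ℂ] B) : U →L[ℂ] WithLp 2 (A × B) :=
  (WithLp.prodContinuousLinearEquiv 2 ℂ A B).symm.toContinuousLinearMap.comp (f.prod g)

/-- The injection `A → A ⊕ B`. -/
def inl (A : Type u) [NormedAddCommGroup A] [InnerProductSpace ℂ A]
    (B : Type v) [NormedAddCommGroup B] [InnerProductSpace ℂ B] : A →L[ℂ] WithLp 2 (A × B) :=
  pair (ContinuousLinearMap.id ℂ A) 0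

/-- The injection `B → A ⊕ B`. -/
def inr (A : Type u) [NormedAddCommGroup A] [InnerProductSpace ℂ A]
    (B : Type v) [NormedAddCommGroup B] [InnerProductSpace ℂ B] : B →L[ℂ] WithLp 2 (A × B) :=
  pair 0 (ContinuousLinearMap.id ℂ B)

@[simp] theorem fst_apply (x : WithLp 2 (A × B)) : fst A B x = x.fst := rfl
@[simp] theorem snd_apply (x : WithLp 2 (A × B)) : snd A B x = x.snd := rfl
@[simp] theorem pair_fst (f : U →L[ℂ] A) (g : U →L[ℂ] B) (x : U) : (pair f g x).fst = f x := rfl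
@[simp] theorem pair_snd (f : U →L[ℂ] A) (g : U →L[ℂ] B) (x : U) : (pair f g x).snd = g x := rfl

theorem norm_le_iff {X : Type u} [NormedAddCommGroup X] {Y : Type v} [NormedAddCommGroup Y]
    {x : X} {y : Y} : ‖x‖ ≤ ‖y‖ ↔ ‖x‖ ^ 2 ≤ ‖y‖ ^ 2 :=
  (pow_le_pow_iff_left₀ (norm_nonneg _) (norm_nonneg _) two_ne_zero).symm

end DirectSum2

open DirectSum2

/-- The component `f_BA : A → B` of `f : A ⊕ U → B ⊕ U`. -/
def compBA (f : WithLp 2 (A × U) →L[ℂ] WithLp 2 (B × U)) : A →L[ℂ] B :=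
  fst B U ∘L f ∘L inl A U

/-- The component `f_BU : U → B` of `f : A ⊕ U → B ⊕ U`. -/
def compBU (f : WithLp 2 (A × U) →L[ℂ] WithLp 2 (B × U)) : U →L[ℂ] B :=
  fst B U ∘L f ∘L inr A U

/-- The component `f_UA : A → U` of `f : A ⊕ U → B ⊕ U`. -/
def compUA (f : WithLp 2 (A × U) →L[ℂ] WithLp 2 (B × U)) : A →L[ℂ] U :=
  snd B U ∘L f ∘L inl A U

/-- The component `f_UU : U → U` of `f : A ⊕ U → B ⊕ U`. -/
def compUU (f : WithLp 2 (A × U) →L[ℂ] WithLp 2 (B × U)) : U →L[ℂ] U :=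
  snd B U ∘L f ∘L inr A U

/-- The family `{f_BA} ⊎ {f_BU f_UU ^ n f_UA}_{n ∈ ℕ}` of the execution formula. -/
def exFamily (f : WithLp 2 (A × U) →L[ℂ] WithLp 2 (B × U)) : Unit ⊕ ℕ → (A →L[ℂ] B) :=
  Sum.elim (fun _ => compBA f) (fun n => compBU f ∘L (compUU f ^ n) ∘L compUA f)

/-- `(k, i)` witnesses the kernel-image trace of `f : A ⊕ U → B ⊕ U`. -/
def KiWitness (f : WithLp 2 (A × U) →L[ℂ] WithLp 2 (B × U)) (k : U →L[ℂ] B) (i : A →L[ℂ] U) :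
    Prop :=
  (ContinuousLinearMap.id ℂ U - compUU f) ∘L i = compUA f ∧
    k ∘L (ContinuousLinearMap.id ℂ U - compUU f) = compBU f

/-- The kernel-image trace, a partial operator: it is defined on `f` if `f` has a witness `(k, i)`,
with value `f_BA + k f_UA`. -/
def kiTrace : (WithLp 2 (A × U) →L[ℂ] WithLp 2 (B × U)) →. (A →L[ℂ] B) := fun f =>
  ⟨∃ k i, KiWitness f k i, fun h => compBA f + h.choose ∘L compUA f⟩

/-- The value of the kernel-image trace does not depend on the witness, and it is also
`f_BA + f_BU i`. -/
theorem KiWitness.mem_kiTrace {f : WithLp 2 (A × U) →L[ℂ] WithLp 2 (B × U)} {k : U →L[ℂ] B}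
    {i : A →L[ℂ] U} (h : KiWitness f k i) :
    compBA f + k ∘L compUA f ∈ kiTrace f ∧
      compBA f + k ∘L compUA f = compBA f + compBU f ∘L i := by
  have key : ∀ k' : U →L[ℂ] B, k' ∘L (ContinuousLinearMap.id ℂ U - compUU f) = compBU f →
      k' ∘L compUA f = compBU f ∘L i := by
    intro k' hk'
    rw [← h.1, ← hk', ContinuousLinearMap.comp_assoc]
  have hex : ∃ k i, KiWitness f k i := ⟨k, i, h⟩
  refine ⟨⟨hex, ?_⟩, by rw [key k h.2]⟩
  have h' := hex.choose_spec.choose_spec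
  change compBA f + hex.choose ∘L compUA f = _
  rw [key _ h'.2, key k h.2]

end Operators

/-! ### The symmetric monoidal category of finite-dimensional Hilbert spaces and contractions -/

/-- The objects: finite-dimensional complex Hilbert spaces (completeness is automatic). -/
structure FdContraction : Type (u + 1) where
  carrier : Type u
  [normedAddCommGroup : NormedAddCommGroup carrier]
  [innerProductSpace : InnerProductSpace ℂ carrier]
  [finiteDimensional : FiniteDimensional ℂ carrier]

namespace FdContraction

open DirectSum2

instance : CoeSort FdContraction.{u} (Type u) := ⟨carrier⟩

attribute [instance] normedAddCommGroup innerProductSpace finiteDimensional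

/-- The morphisms: contractions. -/
@[ext] structure Hom (A B : FdContraction.{u}) where
  toCLM : A →L[ℂ] B
  isContraction : IsContraction toCLM

instance : Category FdContraction.{u} where
  Hom := Hom
  id A := ⟨ContinuousLinearMap.id ℂ A, fun _ => le_rfl⟩
  comp f g := ⟨g.toCLM ∘L f.toCLM, fun a => (g.isContraction _).trans (f.isContraction a)⟩

/-- The underlying bounded linear map of a morphism. -/
abbrev clm {A B : FdContraction.{u}} (f : A ⟶ B) : A →L[ℂ] B := Hom.toCLM f

theorem hom_ext {A B : FdContraction.{u}} {f g : A ⟶ B} (h : ∀ x, clm f x = clm g x) : f = g :=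
  Hom.ext (ContinuousLinearMap.ext h)

@[simp] theorem clm_id (A : FdContraction.{u}) (x : A) : clm (𝟙 A) x = x := rfl
@[simp] theorem clm_comp {A B C : FdContraction.{u}} (f : A ⟶ B) (g : B ⟶ C) (x : A) :
    clm (f ≫ g) x = clm g (clm f x) := rfl

/-- The direct sum `A ⊕ B`, with inner product `⟪a, a'⟫ + ⟪b, b'⟫`. -/
abbrev sum (A B : FdContraction.{u}) : FdContraction.{u} := ⟨WithLp 2 (A × B)⟩

/-- The zero-dimensional Hilbert space. -/
abbrev zero : FdContraction.{u} := ⟨PUnit⟩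

/-- The direct sum `f ⊕ g` of contractions. -/
def sumMap {A B C D : FdContraction.{u}} (f : A ⟶ B) (g : C ⟶ D) : sum A C ⟶ sum B D :=
  Hom.mk (pair (clm f ∘L fst A C) (clm g ∘L snd A C)) fun x => by
    have h₁ := norm_le_iff.1 (f.isContraction x.fst)
    have h₂ := norm_le_iff.1 (g.isContraction x.snd)
    rw [norm_le_iff, WithLp.prod_norm_sq_eq_of_L2, WithLp.prod_norm_sq_eq_of_L2]
    exact add_le_add h₁ h₂

/-- `(A ⊕ B) ⊕ C ≅ A ⊕ (B ⊕ C)`. -/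
def assoc (A B C : FdContraction.{u}) : sum (sum A B) C ≅ sum A (sum B C) where
  hom := Hom.mk (pair (fst A B ∘L fst (sum A B) C) (pair (snd A B ∘L fst (sum A B) C)
      (snd (sum A B) C))) fun x => by
    rw [norm_le_iff]
    simp only [WithLp.prod_norm_sq_eq_of_L2]
    simp [add_assoc]
  inv := Hom.mk (pair (pair (fst A (sum B C)) (fst B C ∘L snd A (sum B C)))
      (snd B C ∘L snd A (sum B C))) fun x => by
    rw [norm_le_iff]
    simp only [WithLp.prod_norm_sq_eq_of_L2]
    simp [add_assoc]
  hom_inv_id := hom_ext fun _ => rfl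
  inv_hom_id := hom_ext fun _ => rfl

/-- `0 ⊕ A ≅ A`. -/
def leftUnit (A : FdContraction.{u}) : sum zero A ≅ A where
  hom := Hom.mk (snd zero A) fun x => by
    rw [norm_le_iff, WithLp.prod_norm_sq_eq_of_L2]
    simp
  inv := Hom.mk (inr zero A) fun x => by
    rw [norm_le_iff, WithLp.prod_norm_sq_eq_of_L2]
    simp [inr]
  hom_inv_id := hom_ext fun _ => rfl
  inv_hom_id := hom_ext fun _ => rfl

/-- `A ⊕ 0 ≅ A`. -/
def rightUnit (A : FdContraction.{u}) : sum A zero ≅ A where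
  hom := Hom.mk (fst A zero) fun x => by
    rw [norm_le_iff, WithLp.prod_norm_sq_eq_of_L2]
    simp
  inv := Hom.mk (inl A zero) fun x => by
    rw [norm_le_iff, WithLp.prod_norm_sq_eq_of_L2]
    simp [inl]
  hom_inv_id := hom_ext fun _ => rfl
  inv_hom_id := hom_ext fun _ => rfl

/-- The symmetry `A ⊕ B ≅ B ⊕ A`. -/
def swap (A B : FdContraction.{u}) : sum A B ≅ sum B A where
  hom := Hom.mk (pair (snd A B) (fst A B)) fun x => by
    rw [norm_le_iff, WithLp.prod_norm_sq_eq_of_L2, WithLp.prod_norm_sq_eq_of_L2]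
    simp [add_comm]
  inv := Hom.mk (pair (snd B A) (fst B A)) fun x => by
    rw [norm_le_iff, WithLp.prod_norm_sq_eq_of_L2, WithLp.prod_norm_sq_eq_of_L2]
    simp [add_comm]
  hom_inv_id := hom_ext fun _ => rfl
  inv_hom_id := hom_ext fun _ => rfl

instance : MonoidalCategoryStruct FdContraction.{u} where
  tensorObj := sum
  tensorHom f g := sumMap f g
  whiskerLeft A _ _ f := sumMap (𝟙 A) f
  whiskerRight f A := sumMap f (𝟙 A)
  tensorUnit := zero
  associator := assoc
  leftUnitor := leftUnit
  rightUnitor := rightUnit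

instance : MonoidalCategory FdContraction.{u} where
  tensorHom_def _ _ := hom_ext fun _ => rfl
  id_tensorHom_id _ _ := hom_ext fun _ => rfl
  tensorHom_comp_tensorHom _ _ _ _ := hom_ext fun _ => rfl
  whiskerLeft_id _ _ := hom_ext fun _ => rfl
  id_whiskerRight _ _ := hom_ext fun _ => rfl
  associator_naturality _ _ _ := hom_ext fun _ => rfl
  leftUnitor_naturality _ := hom_ext fun _ => rfl
  rightUnitor_naturality _ := hom_ext fun _ => rfl
  pentagon _ _ _ _ := hom_ext fun _ => rfl
  triangle _ _ := hom_ext fun _ => rfl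

instance : SymmetricCategory FdContraction.{u} where
  braiding := swap
  braiding_naturality_right _ _ _ _ := hom_ext fun _ => rfl
  braiding_naturality_left _ _ := hom_ext fun _ => rfl
  hexagon_forward _ _ _ := hom_ext fun _ => rfl
  hexagon_reverse _ _ _ := hom_ext fun _ => rfl
  symmetry _ _ := hom_ext fun _ => rfl

/-- The underlying bounded operator between direct sums of a morphism `A ⊕ U ⟶ B ⊕ U`. -/
abbrev sumClm {A B U : FdContraction.{u}} (f : A ⊗ U ⟶ B ⊗ U) :
    WithLp 2 (A × U) →L[ℂ] WithLp 2 (B × U) := Hom.toCLM f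

/-- The execution formula, a partial operator on contractions: `ex f` is defined, with value the
contraction `g`, if the net of finite partial sums of the family
`{f_BA} ⊎ {f_BU f_UU ^ n f_UA}_{n ∈ ℕ}` converges to `g` in the operator norm. -/
def ex {A B U : FdContraction.{u}} : (A ⊗ U ⟶ B ⊗ U) →. (A ⟶ B) := fun f =>
  ⟨∃ g : A ⟶ B, HasSum (exFamily (sumClm f)) (clm g), fun h => h.choose⟩

theorem mem_ex_iff {A B U : FdContraction.{u}} (f : A ⊗ U ⟶ B ⊗ U) (g : A ⟶ B) :
    g ∈ ex f ↔ HasSum (exFamily (sumClm f)) (clm g) := by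
  constructor
  · rintro ⟨h, rfl⟩
    exact h.choose_spec
  · intro hg
    have h : ∃ g : A ⟶ B, HasSum (exFamily (sumClm f)) (clm g) := ⟨g, hg⟩
    exact ⟨h, Hom.ext (h.choose_spec.unique hg)⟩

end FdContraction

end

open Filter Topology DirectSum2

/-! The powers of T = f_UU need not decay, since T may have eigenvalues on the unit circle. But if T
v = μ v with |μ| = 1, then v already uses up the whole norm of the output: f (0, v) = (0, μ v), so
f_BU v = 0. A contraction preserves inner products with a vector whose norm it keeps, so the
orthogonal complement K of all such v is T-invariant and contains the range of f_UA. All eigenvalues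
of T on K lie in the open disc, so the series converges (`IsContraction.exists_hasSum_exFamily`),
and its Neumann sum provides i. The witness k exists because f_BU vanishes on ker (1 - T).

The limit t satisfies a feedback relation: t a = b exactly when f (a, x) = (b, x) for some x.
Comparing norms shows that this relation is single-valued and that t is a contraction. Each trace
axiom then only asks for a suitable x (`FdContraction.ex_apply_eq`). -/

theorem LinearMap.exists_comp_eq_of_ker_le_ker {K V W W' : Type*} [DivisionRing K]
    [AddCommGroup V] [Module K V] [AddCommGroup W] [Module K W] [AddCommGroup W'] [Module K W']
    {g : V →ₗ[K] W} {b : V →ₗ[K] W'} (h : LinearMap.ker g ≤ LinearMap.ker b) :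
    ∃ k : W →ₗ[K] W', k ∘ₗ g = b := by
  -- Choose preimages linearly on the range of `g`, apply `b`, and extend to all of `W`; the kernel
  -- condition makes the choice harmless.
  obtain ⟨s, hs⟩ := g.rangeRestrict.exists_rightInverse_of_surjective g.range_rangeRestrict
  obtain ⟨k, hk⟩ := (b ∘ₗ s).exists_extend
  refine ⟨k, LinearMap.ext fun x => ?_⟩
  have h₁ : k (g x) = b (s (g.rangeRestrict x)) := LinearMap.congr_fun hk (g.rangeRestrict x)
  have h₂ : g (s (g.rangeRestrict x)) = g x :=
    congrArg Subtype.val (LinearMap.congr_fun hs (g.rangeRestrict x))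
  have h₃ : s (g.rangeRestrict x) - x ∈ LinearMap.ker b :=
    h (by rw [LinearMap.mem_ker, map_sub, h₂, sub_self])
  rw [LinearMap.mem_ker, map_sub, sub_eq_zero] at h₃
  rw [LinearMap.comp_apply, h₁, h₃]

/-! ### Summability of the powers of an operator. -/

section PowerSummability

/-- Root test: in a complex Banach algebra, the powers of an element whose spectrum lies in the open
unit disc are summable. -/
theorem summable_pow_of_spectralRadius_lt_one {R : Type*} [NormedRing R] [NormedAlgebra ℂ R]
    [CompleteSpace R] {a : R} (ha : spectralRadius ℂ a < 1) : Summable fun n : ℕ => a ^ n := by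
  obtain ⟨r, har, hr⟩ := ENNReal.lt_iff_exists_nnreal_btwn.1 ha
  have hr1 : (r : ℝ) < 1 := by exact_mod_cast hr
  have hev := (spectrum.pow_nnnorm_pow_one_div_tendsto_nhds_spectralRadius a).eventually_lt_const har
  refine Summable.of_norm_bounded_eventually_nat
    (summable_geometric_of_lt_one r.coe_nonneg hr1) ?_
  filter_upwards [hev, eventually_gt_atTop 0] with n hn hpos
  have hn0 : (n : ℝ) ≠ 0 := by positivity
  have h := ENNReal.rpow_le_rpow hn.le (Nat.cast_nonneg n : (0 : ℝ) ≤ n)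
  rw [← ENNReal.rpow_mul, one_div_mul_cancel hn0, ENNReal.rpow_one, ENNReal.rpow_natCast] at h
  exact_mod_cast h

variable {V : Type*} [NormedAddCommGroup V] [NormedSpace ℂ V] [FiniteDimensional ℂ V]

theorem ContinuousLinearMap.exists_eigenvector_of_mem_spectrum {S : V →L[ℂ] V} {μ : ℂ}
    (hμ : μ ∈ spectrum ℂ S) : ∃ x : V, x ≠ 0 ∧ S x = μ • x := by
  have hS : μ ∈ spectrum ℂ (S : Module.End ℂ V) := by
    rw [← AlgEquiv.spectrum_eq (Module.End.toContinuousLinearMap V)]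
    exact hμ
  obtain ⟨x, hx⟩ := (Module.End.hasEigenvalue_iff_mem_spectrum.2 hS).exists_hasEigenvector
  exact ⟨x, hx.2, hx.apply_eq_smul⟩

theorem ContinuousLinearMap.summable_pow_of_eigenvalue_norm_lt_one {S : V →L[ℂ] V}
    (hS : ∀ (μ : ℂ) (x : V), x ≠ 0 → S x = μ • x → ‖μ‖ < 1) : Summable fun n : ℕ => S ^ n := by
  have : CompleteSpace V := FiniteDimensional.complete ℂ V
  apply summable_pow_of_spectralRadius_lt_one
  -- On a nonzero space the spectrum is compact and nonempty, so pointwise strict bounds bound its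
  -- radius strictly; the zero space is separate.
  rcases subsingleton_or_nontrivial V with hV | hV
  · rw [Subsingleton.elim S 0]
    simp
  · refine spectrum.spectralRadius_lt_of_forall_lt S (r := 1) fun μ hμ => ?_
    obtain ⟨x, hx, hSx⟩ := exists_eigenvector_of_mem_spectrum hμ
    exact_mod_cast hS μ x hx hSx

end PowerSummability

/-! ### Equality case for contractions. -/

section Contractions

variable {X : Type u} [NormedAddCommGroup X] [InnerProductSpace ℂ X] [CompleteSpace X]
  {Y : Type v} [NormedAddCommGroup Y] [InnerProductSpace ℂ Y] [CompleteSpace Y]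

/-- A contraction preserves inner products with any vector whose norm it preserves. -/
theorem IsContraction.inner_map_map_of_norm_eq {g : X →L[ℂ] Y} (hg : IsContraction g) {u : X}
    (hu : ‖g u‖ = ‖u‖) (x : X) : inner ℂ (g u) (g x) = inner ℂ u x := by
  have hadj : ‖g.adjoint (g u)‖ ≤ ‖u‖ := by
    refine (g.adjoint.le_opNorm _).trans ?_
    rw [LinearIsometryEquiv.norm_map, hu]
    exact mul_le_of_le_one_left (norm_nonneg _)
      (g.opNorm_le_bound zero_le_one fun x => by simpa using hg x)
  -- ‖g*g u - u‖² = ‖g*g u‖² - 2‖g u‖² + ‖u‖² ≤ 0, as g* is also a contraction.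
  have hfix : g.adjoint (g u) = u := by
    have h := norm_sub_sq (𝕜 := ℂ) (g.adjoint (g u)) u
    rw [ContinuousLinearMap.adjoint_inner_left, inner_self_eq_norm_sq, hu] at h
    have h2 : ‖g.adjoint (g u)‖ ^ 2 ≤ ‖u‖ ^ 2 := pow_le_pow_left₀ (norm_nonneg _) hadj 2
    have h3 : ‖g.adjoint (g u) - u‖ ^ 2 = 0 := le_antisymm (by linarith) (sq_nonneg _)
    exact sub_eq_zero.1 (norm_eq_zero.1 (pow_eq_zero_iff two_ne_zero |>.1 h3))
  rw [← ContinuousLinearMap.adjoint_inner_left, hfix]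

end Contractions

/-! ### Feedback through U and convergence of the execution formula. -/

section Feedback

variable {A : Type u} [NormedAddCommGroup A] [InnerProductSpace ℂ A]
  {B : Type v} [NormedAddCommGroup B] [InnerProductSpace ℂ B]
  {U : Type w} [NormedAddCommGroup U] [InnerProductSpace ℂ U]

theorem map_toLp_fst (f : WithLp 2 (A × U) →L[ℂ] WithLp 2 (B × U)) (a : A) (x : U) :
    (f (WithLp.toLp 2 (a, x))).fst = compBA f a + compBU f x := by
  have : WithLp.toLp 2 (a, x) = inl A U a + inr A U x := by
    apply WithLp.ofLp_injective 2
    ext <;> simp [inl, inr, pair]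
  rw [this, map_add]
  rfl

theorem map_toLp_snd (f : WithLp 2 (A × U) →L[ℂ] WithLp 2 (B × U)) (a : A) (x : U) :
    (f (WithLp.toLp 2 (a, x))).snd = compUA f a + compUU f x := by
  have : WithLp.toLp 2 (a, x) = inl A U a + inr A U x := by
    apply WithLp.ofLp_injective 2
    ext <;> simp [inl, inr, pair]
  rw [this, map_add]
  rfl

theorem IsContraction.norm_sq_components_le {f : WithLp 2 (A × U) →L[ℂ] WithLp 2 (B × U)}
    (hf : IsContraction f) (a : A) (x : U) :
    ‖compBA f a + compBU f x‖ ^ 2 + ‖compUA f a + compUU f x‖ ^ 2 ≤ ‖a‖ ^ 2 + ‖x‖ ^ 2 := by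
  have h := norm_le_iff.1 (hf (WithLp.toLp 2 (a, x)))
  rw [WithLp.prod_norm_sq_eq_of_L2, WithLp.prod_norm_sq_eq_of_L2, map_toLp_fst,
    map_toLp_snd] at h
  exact h

theorem IsContraction.compUU {f : WithLp 2 (A × U) →L[ℂ] WithLp 2 (B × U)}
    (hf : IsContraction f) : IsContraction (compUU f) := fun x => by
  have h := hf.norm_sq_components_le 0 x
  simp only [map_zero, zero_add, norm_zero, ne_eq, OfNat.ofNat_ne_zero, not_false_eq_true,
    zero_pow] at h
  rw [norm_le_iff]
  linarith [sq_nonneg ‖compBU f x‖]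

/-- The output component of a contraction vanishes on the unimodular eigenvectors of the feedback
component. -/
theorem IsContraction.compBU_eq_zero {f : WithLp 2 (A × U) →L[ℂ] WithLp 2 (B × U)}
    (hf : IsContraction f) {μ : ℂ} (hμ : ‖μ‖ = 1) {x : U} (hx : _root_.compUU f x = μ • x) :
    compBU f x = 0 := by
  have h := hf.norm_sq_components_le 0 x
  simp only [map_zero, zero_add, norm_zero, ne_eq, OfNat.ofNat_ne_zero, not_false_eq_true,
    zero_pow, hx, norm_smul, hμ, one_mul] at h
  have h0 : ‖compBU f x‖ ^ 2 = 0 := le_antisymm (by linarith) (sq_nonneg _)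
  exact norm_eq_zero.1 (pow_eq_zero_iff two_ne_zero |>.1 h0)

/-- The orthogonal complement of the eigenvectors of `T` with unimodular eigenvalue. -/
def unimodularComplement (T : U →L[ℂ] U) : Submodule ℂ U where
  carrier := {x | ∀ (μ : ℂ) (v : U), ‖μ‖ = 1 → T v = μ • v → inner ℂ v x = 0}
  add_mem' hx hy μ v hμ hv := by rw [inner_add_right, hx μ v hμ hv, hy μ v hμ hv, add_zero]
  zero_mem' μ v _ _ := inner_zero_right v
  smul_mem' c x hx μ v hμ hv := by rw [inner_smul_right, hx μ v hμ hv, mul_zero]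

/-- A vector of ker (1 - f_UU) is an eigenvector for μ = 1, so f_BU kills it and factors through 1 -
f_UU. -/
theorem IsContraction.exists_comp_eq_compBU [FiniteDimensional ℂ U]
    {f : WithLp 2 (A × U) →L[ℂ] WithLp 2 (B × U)} (hf : IsContraction f) :
    ∃ k : U →L[ℂ] B, k ∘L (ContinuousLinearMap.id ℂ U - _root_.compUU f) = compBU f := by
  obtain ⟨k, hk⟩ := LinearMap.exists_comp_eq_of_ker_le_ker
    (g := (ContinuousLinearMap.id ℂ U - _root_.compUU f : U →L[ℂ] U).toLinearMap)
    (b := (compBU f).toLinearMap) fun x hx => by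
      have hx' : x - _root_.compUU f x = 0 := hx
      exact hf.compBU_eq_zero norm_one (by rw [one_smul, ← sub_eq_zero.1 hx'])
  exact ⟨LinearMap.toContinuousLinearMap k, ContinuousLinearMap.ext (LinearMap.congr_fun hk)⟩

/-- The term ‖x‖² occurs on both sides of the norm inequality and cancels. -/
theorem IsContraction.of_feedback {f : WithLp 2 (A × U) →L[ℂ] WithLp 2 (B × U)}
    (hf : IsContraction f) {t : A →L[ℂ] B}
    (ht : ∀ a, ∃ x, f (WithLp.toLp 2 (a, x)) = WithLp.toLp 2 (t a, x)) : IsContraction t := by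
  intro a
  obtain ⟨x, hx⟩ := ht a
  have h := norm_le_iff.1 (hf (WithLp.toLp 2 (a, x)))
  rw [hx, WithLp.prod_norm_sq_eq_of_L2, WithLp.prod_norm_sq_eq_of_L2] at h
  exact norm_le_iff.2 (le_of_add_le_add_right h)

/-- The feedback relation of a contraction is single-valued. -/
theorem IsContraction.feedback_unique {f : WithLp 2 (A × U) →L[ℂ] WithLp 2 (B × U)}
    (hf : IsContraction f) {a : A} {b c : B} {x y : U}
    (hx : f (WithLp.toLp 2 (a, x)) = WithLp.toLp 2 (b, x))
    (hy : f (WithLp.toLp 2 (a, y)) = WithLp.toLp 2 (c, y)) : b = c := by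
  have h := norm_le_iff.1 (hf (WithLp.toLp 2 (a, x) - WithLp.toLp 2 (a, y)))
  rw [map_sub, hx, hy, WithLp.prod_norm_sq_eq_of_L2, WithLp.prod_norm_sq_eq_of_L2] at h
  replace h : ‖b - c‖ ^ 2 + ‖x - y‖ ^ 2 ≤ ‖a - a‖ ^ 2 + ‖x - y‖ ^ 2 := h
  rw [sub_self, norm_zero] at h
  have h0 : ‖b - c‖ ^ 2 = 0 := le_antisymm (by linarith) (sq_nonneg _)
  exact sub_eq_zero.1 (norm_eq_zero.1 (pow_eq_zero_iff two_ne_zero |>.1 h0))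

variable [FiniteDimensional ℂ A] [FiniteDimensional ℂ B] [FiniteDimensional ℂ U]

/-- Since f keeps the norm of (0, v), pairing f (0, v) = (0, μ v) with f (a, x) gives conj μ ⟪v,
f_UA a + f_UU x⟫ = ⟪v, x⟫ = 0. The cases x = 0 and a = 0 say that the complement contains the range
of f_UA and is invariant. -/
theorem IsContraction.mem_unimodularComplement {f : WithLp 2 (A × U) →L[ℂ] WithLp 2 (B × U)}
    (hf : IsContraction f) (a : A) {x : U} (hx : x ∈ unimodularComplement (_root_.compUU f)) :
    compUA f a + _root_.compUU f x ∈ unimodularComplement (_root_.compUU f) := by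
  intro μ v hμ hv
  have : CompleteSpace A := FiniteDimensional.complete ℂ A
  have : CompleteSpace B := FiniteDimensional.complete ℂ B
  have : CompleteSpace U := FiniteDimensional.complete ℂ U
  have hfv : f (WithLp.toLp 2 (0, v)) = WithLp.toLp 2 (0, μ • v) := by
    apply WithLp.ofLp_injective 2
    ext
    · simp [map_toLp_fst, hf.compBU_eq_zero hμ hv]
    · simp [map_toLp_snd, hv]
  have hnorm : ‖f (WithLp.toLp 2 (0, v))‖ = ‖(WithLp.toLp 2 (0, v) : WithLp 2 (A × U))‖ := by
    rw [hfv, ← sq_eq_sq₀ (norm_nonneg _) (norm_nonneg _), WithLp.prod_norm_sq_eq_of_L2,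
      WithLp.prod_norm_sq_eq_of_L2]
    simp [norm_smul, hμ]
  have h := hf.inner_map_map_of_norm_eq hnorm (WithLp.toLp 2 (a, x))
  rw [hfv] at h
  simp only [WithLp.prod_inner_apply, WithLp.ofLp_fst, WithLp.ofLp_snd, map_toLp_snd,
    inner_zero_left, zero_add, inner_smul_left, hx μ v hμ hv] at h
  refine (mul_eq_zero.1 h).resolve_left fun h0 => ?_
  have : μ = 0 := by simpa using h0
  simp [this] at hμ

/-- Precomposed with the projection onto its unimodular complement, a contraction has all its
eigenvalues in the open unit disc, so that its powers are summable. -/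
theorem IsContraction.summable_pow_comp_starProjection {T : U →L[ℂ] U} (hT : IsContraction T) :
    Summable fun n : ℕ => (T ∘L (unimodularComplement T).starProjection) ^ n := by
  refine ContinuousLinearMap.summable_pow_of_eigenvalue_norm_lt_one fun μ x hx0 hx => ?_
  -- If |μ| ≥ 1, then |μ|‖x‖ ≤ ‖P x‖ ≤ ‖x‖ are equalities. So x lies in the complement and is itself
  -- a unimodular eigenvector of T, hence orthogonal to itself.
  by_contra! hμ
  have hxpos : 0 < ‖x‖ := norm_pos_iff.2 hx0
  set K := unimodularComplement T
  have hchain : ‖μ‖ * ‖x‖ ≤ ‖K.starProjection x‖ := by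
    rw [← norm_smul, ← hx]
    exact hT _
  have hP : ‖K.starProjection x‖ ≤ ‖x‖ := K.norm_starProjection_apply_le x
  have hμ1 : ‖μ‖ = 1 := le_antisymm (by nlinarith) hμ
  have hnorm : ‖K.starProjection x‖ = ‖x‖ := le_antisymm hP (by rwa [hμ1, one_mul] at hchain)
  have hmem : x ∈ K := (K.mem_iff_norm_starProjection x).2 hnorm
  have hTx : T x = μ • x := by
    rwa [ContinuousLinearMap.comp_apply, Submodule.starProjection_eq_self_iff.2 hmem] at hx
  exact hx0 (inner_self_eq_zero.1 (hmem μ x hμ1 hTx))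

/-- For a contraction `f`, the feedback equation `i = f_UA + f_UU i` has a solution for which
`f_BA + f_BU i` is the sum of the execution formula. -/
theorem IsContraction.exists_hasSum_exFamily {f : WithLp 2 (A × U) →L[ℂ] WithLp 2 (B × U)}
    (hf : IsContraction f) :
    ∃ i : A →L[ℂ] U, (ContinuousLinearMap.id ℂ U - _root_.compUU f) ∘L i = compUA f ∧
      HasSum (exFamily f) (compBA f + compBU f ∘L i) := by
  have : CompleteSpace U := FiniteDimensional.complete ℂ U
  set T := _root_.compUU f
  set K := unimodularComplement T
  have hUA : ∀ a, compUA f a ∈ K := fun a => by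
    simpa using hf.mem_unimodularComplement a K.zero_mem
  have hTK : ∀ x ∈ K, T x ∈ K := fun x hx => by
    simpa using hf.mem_unimodularComplement 0 hx
  set S : U →L[ℂ] U := T ∘L K.starProjection
  have hSK : ∀ x, S x ∈ K := fun x => hTK _ (K.starProjection_apply_mem x)
  have hST : ∀ x ∈ K, S x = T x := fun x hx => by
    simp only [S, ContinuousLinearMap.comp_apply, Submodule.starProjection_eq_self_iff.2 hx]
  have hsum : Summable (S ^ ·) := hf.compUU.summable_pow_comp_starProjection
  set R : U →L[ℂ] U := ∑' n, S ^ n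
  have hR : (1 - S) * R = 1 := hsum.one_sub_mul_tsum_pow
  have hRx : ∀ x, R x = x + S (R x) := fun x => by
    have := DFunLike.congr_fun hR x
    simp only [sub_mul, one_mul, sub_apply, mul_apply_eq_comp,
      one_apply_eq_self] at this
    exact sub_eq_iff_eq_add.1 this
  -- The orbit of f_UA a never leaves K, where S and T agree, so S may replace T in the series.
  have hpow : ∀ n a, (S ^ n) (compUA f a) = (T ^ n) (compUA f a) ∧ (S ^ n) (compUA f a) ∈ K := by
    intro n a
    induction n with
    | zero => exact ⟨rfl, hUA a⟩
    | succ n ih =>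
      simp only [pow_succ', mul_apply_eq_comp]
      exact ⟨by rw [hST _ ih.2, ih.1], hSK _⟩
  refine ⟨R ∘L compUA f, ?_, ?_⟩
  · ext a
    have hmem : R (compUA f a) ∈ K := by
      rw [hRx]
      exact K.add_mem (hUA a) (hSK _)
    simp only [ContinuousLinearMap.comp_apply, sub_apply,
      ContinuousLinearMap.id_apply]
    rw [← hST _ hmem]
    nth_rw 1 [hRx]
    exact add_sub_cancel_right _ _
  -- Split off the single term f_BA, then push the Neumann series through the continuous additive
  -- map X ↦ f_BU X f_UA.
  · refine HasSum.sum (hasSum_unique _) ?_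
    have hL : Continuous fun X : U →L[ℂ] U => compBU f ∘L X ∘L compUA f := by fun_prop
    have h := hsum.hasSum.map (AddMonoidHom.mk' (fun X : U →L[ℂ] U => compBU f ∘L X ∘L compUA f)
      fun X Y => by ext; simp) hL
    convert h using 1
    · funext n
      ext a
      exact congrArg (compBU f) (hpow n a).1.symm
    · rfl

/-- The sum of the execution formula of a contraction exists, is the kernel-image trace, and sends
`a` to the `b` with `f (a, x) = (b, x)` for some `x`. -/
theorem IsContraction.exists_hasSum_mem_kiTrace
    {f : WithLp 2 (A × U) →L[ℂ] WithLp 2 (B × U)} (hf : IsContraction f) :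
    ∃ t : A →L[ℂ] B, HasSum (exFamily f) t ∧ t ∈ kiTrace f ∧
      ∀ a, ∃ x, f (WithLp.toLp 2 (a, x)) = WithLp.toLp 2 (t a, x) := by
  obtain ⟨i, hi, hsum⟩ := hf.exists_hasSum_exFamily
  obtain ⟨k, hk⟩ := hf.exists_comp_eq_compBU
  have hki : KiWitness f k i := ⟨hi, hk⟩
  refine ⟨_, hsum, hki.mem_kiTrace.2 ▸ hki.mem_kiTrace.1, fun a => ⟨i a, ?_⟩⟩
  have hia : i a - _root_.compUU f (i a) = compUA f a := DFunLike.congr_fun hi a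
  apply WithLp.ofLp_injective 2
  ext
  · exact map_toLp_fst f a (i a)
  · exact (map_toLp_snd f a (i a)).trans (by rw [← hia, sub_add_cancel])

end Feedback

/-! ### The trace axioms, by exhibiting feedback vectors. -/

namespace FdContraction

theorem ex_dom {A B U : FdContraction.{u}} (f : A ⊗ U ⟶ B ⊗ U) : (ex f).Dom := by
  obtain ⟨t, ht, -, hfb⟩ :=
    IsContraction.exists_hasSum_mem_kiTrace (f := sumClm f) (Hom.isContraction f)
  exact ⟨⟨t, IsContraction.of_feedback (f := sumClm f) (Hom.isContraction f) hfb⟩, ht⟩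

theorem exists_feedback_ex {A B U : FdContraction.{u}} (f : A ⊗ U ⟶ B ⊗ U) (h : (ex f).Dom)
    (a : A) : ∃ x : U,
      sumClm f (WithLp.toLp 2 (a, x)) = WithLp.toLp 2 (clm ((ex f).get h) a, x) := by
  obtain ⟨t, ht, -, hfb⟩ :=
    IsContraction.exists_hasSum_mem_kiTrace (f := sumClm f) (Hom.isContraction f)
  rw [((mem_ex_iff f _).1 (Part.get_mem h)).unique ht]
  exact hfb a

theorem ex_apply_eq {A B U : FdContraction.{u}} (f : A ⊗ U ⟶ B ⊗ U) (h : (ex f).Dom)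
    {a : A} {b : B} (x : U) (hx : sumClm f (WithLp.toLp 2 (a, x)) = WithLp.toLp 2 (b, x)) :
    clm ((ex f).get h) a = b := by
  obtain ⟨y, hy⟩ := exists_feedback_ex f h a
  exact IsContraction.feedback_unique (f := sumClm f) (Hom.isContraction f) hy hx

theorem isTrace_ex : IsTrace fun {A B U : FdContraction.{u}} (f : A ⊗ U ⟶ B ⊗ U) =>
    (ex f).get (ex_dom f) where
  naturality {A A' B B' U} f g h := hom_ext fun a => by
    obtain ⟨x, hx⟩ := exists_feedback_ex f (ex_dom f) (clm g a)
    refine (ex_apply_eq _ _ x ?_).symm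
    change clm (h ▷ U) (sumClm f (WithLp.toLp 2 (clm g a, x))) = _
    rw [hx]
    rfl
  dinaturality {A B U U'} f g := hom_ext fun a => by
    obtain ⟨x, hx⟩ := exists_feedback_ex ((A ◁ g) ≫ f) (ex_dom _) a
    -- From f (a, g x) = (b, x), applying g to the second component gives the feedback vector g x.
    refine ex_apply_eq _ _ (clm g x) ?_
    exact congrArg (clm (B ◁ g)) hx
  superposing {A B C' D U} f g := hom_ext fun c => by
    obtain ⟨x, hx⟩ := exists_feedback_ex f (ex_dom f) c.snd
    refine (ex_apply_eq _ _ x ?_).symm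
    exact congrArg (fun y : WithLp 2 (B × U) =>
      clm (α_ D B U).inv (WithLp.toLp 2 (clm g c.fst, y))) hx
  vanishing_one {A B} f := hom_ext fun a => ex_apply_eq _ _ 0 rfl
  vanishing_two {A B U V} f := hom_ext fun a => by
    obtain ⟨x, hx⟩ := exists_feedback_ex ((ex f).get (ex_dom f)) (ex_dom _) a
    obtain ⟨y, hy⟩ := exists_feedback_ex f (ex_dom f) (WithLp.toLp 2 (a, x))
    -- The outer feedback x and the inner feedback y at (a, x) combine into one for U ⊕ V.
    refine (ex_apply_eq _ _ (WithLp.toLp 2 (x, y)) ?_).symm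
    have hy' := hy.trans (congrArg (fun z => WithLp.toLp 2 (z, y)) hx)
    exact congrArg (clm (α_ B U V).hom) hy'
  -- The symmetry fixes (a, a).
  yanking U := hom_ext fun a => ex_apply_eq _ _ a rfl

end FdContraction

theorem mainTheorem2 :
    IsTotallyTraced FdContraction.{u} FdContraction.ex ∧
    ∀ (A B U : FdContraction.{u}) (f : WithLp 2 (A × U) →L[ℂ] WithLp 2 (B × U)),
      IsContraction f →
        ∃ t : A →L[ℂ] B, HasSum (exFamily f) t ∧ kiTrace f = Part.some t ∧ IsContraction t := by
  refine ⟨⟨FdContraction.ex_dom, FdContraction.isTrace_ex⟩, fun A B U f hf => ?_⟩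
  obtain ⟨t, hsum, hki, hfb⟩ := hf.exists_hasSum_mem_kiTrace
  exact ⟨t, hsum, Part.eq_some_iff.2 hki, hf.of_feedback hfb⟩
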